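/- Let a Dyck path of semilength $m$ be a lattice path from $(0,0)$ to $(2m,0)$ with steps $(1,1)$ (up) and $(1,-1)$ (down) that never goes below the $x$-axis. A peak is an up step immediately followed by a down step, and its height is the height of the starting point of the up step. For $n\ge 1$ let $$G_n(t,z)=\sum_{i\ge 0}\sum_{j\ge 0} g^{(n)}_{i,j}\,z^i t^j,$$ where $g^{(n)}_{i,j}$ is the number of Dyck paths of semilength $i+1$ with exactly $j$ peaks at height $n$, a formal power series with integer coefficients. Let $C(z)=\sum_{m\ge 0}\frac{1}{m+1}\binom{2m}{m}z^m$ be the Catalan generating function, and let $U(m,x)$, $m\in\mathbb Z$, be the Chebyshev polynomials of the second kind: $U(0,x)=1$, $U(1,x)=2x$, $U(m+1,x)=2x\,U(m,x)-U(m-1,x)$ for all $m\in\mathbb Z$ (so $U(-1,x)=0$, $U(-2,x)=-1$). Then $$G_1(t,z)=\frac{1+zC(z)^2}{1-tz-tz^2C(z)^2},$$ and for every $n\ge 2$ $$G_n(t,z)=\frac{G_1(t,z)\,z\,U\!\left(n-4,\frac1{2\sqrt z}\right)-U\!\left(n-2,\frac1{2\sqrt z}\right)}{G_1(t,z)\,z^2\,U\!\left(n-2,\frac1{2\sqrt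 z}\right)-z\,U\!\left(n,\frac1{2\sqrt z}\right)}$$ and $$G_n(t,z)=\frac{1+zG_{n-1}(t,z)}{1-z-z^2G_{n-1}(t,z)}.$$ These identities hold in every field containing the ring $\mathbb Z[[t]][[z]]$ of formal power series, and for either choice of square root $\sqrt z$ of $z$ in that field; all denominators are nonzero. -/

import Mathlib

open Polynomial PowerSeries

/-- The number of peaks at height `n` of the Dyck path `p`: positions `i` such that step `i` is an
up step, step `i + 1` is a down step, and the path is at height `n` just before step `i`
(so the height of a peak is the height of the start point of its up step). -/
def DyckWord.peaksAtHeight (p : DyckWord) (n : ℕ) : ℕ :=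
  ((Finset.range p.toList.length).filter fun i =>
    p.toList[i]? = some DyckStep.U ∧ p.toList[i + 1]? = some DyckStep.D ∧
      (p.toList.take i).count DyckStep.U = (p.toList.take i).count DyckStep.D + n).card

/-- `peakCount n i j` is the number of Dyck paths of semilength `i + 1` having exactly `j` peaks at
height `n`. -/
def peakCount (n i j : ℕ) : ℕ :=
  (Finset.univ.filter fun p : {p : DyckWord // p.semilength = i + 1} =>
    p.1.peaksAtHeight n = j).card

/-- Formal power series in `z` whose coefficients are formal power series in `t`, over `ℤ`. -/
abbrev BiSeries : Type := PowerSeries (PowerSeries ℤ)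

namespace BiSeries

/-- The variable `z`. -/
noncomputable def z : BiSeries := PowerSeries.X

/-- The variable `t`. -/
noncomputable def t : BiSeries := PowerSeries.C (PowerSeries.X : PowerSeries ℤ)

/-- The Catalan generating function `C(z) = ∑ cₙ zⁿ`. -/
noncomputable def catalanGF : BiSeries :=
  PowerSeries.map (Nat.castRingHom (PowerSeries ℤ)) PowerSeries.catalanSeries

/-- `G n = ∑ᵢ ∑ⱼ (peakCount n i j) zⁱ tʲ`. -/
noncomputable def G (n : ℕ) : BiSeries :=
  PowerSeries.mk fun i => PowerSeries.mk fun j => (peakCount n i j : ℤ)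

end BiSeries

/-!
Writing a nonempty Dyck path as `p.nest + q` (first return to the axis) turns any statistic `f` with
`f (p.nest + q) = g p + f q` into the identity `F = 1 + z F' F` between the generating functions
`F`, `F'` of `f`, `g` over all Dyck paths, the empty one included (`DyckWord.genFun_eq_of_nest_add`).

For `f` the number of peaks at height `n + 1`, nesting lowers the height by one and `g` is the
number of peaks at height `n`; since the generating function of the former is `1 + z G (n + 1)`,
this is the recurrence `G (n + 1) (1 - z - z² G n) = 1 + z G n`. For peaks at height `0`, the path
`p.nest` contributes a peak exactly when `p` is empty, so `F' = C + t - 1`. Together with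
`C = 1 + z C²`, the case `f = 0`, this determines `G 0` and then `G 1`.

Solving the recurrence is a matter of iterating a Möbius transformation, and the Chebyshev
polynomials enter through the powers of its matrix: with `s² = z` and
`N n = G 1 z U (n - 4) - U (n - 2)`, evaluated at `1 / (2 s)`, the three-term recurrence of `U` gives
`s (N (n + 2) + N n) = N (n + 1)`, and `G n = N n / (z N (n + 2))` follows by induction
(`eq_chebyshev_div_of_recurrence`).
-/

/-! ### Peaks of words -/

open Finset in
/-- The number of peaks at height `h` of the word `l`, read as a path that starts at height `0`.
The word need not be a Dyck word, and `h` is an integer, so that the first letter can be split off: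
this shifts the height of the remaining word by one in either direction. -/
def peaksFrom (h : ℤ) (l : List DyckStep) : ℕ :=
  #{i ∈ range l.length | l[i]? = some DyckStep.U ∧ l[i + 1]? = some DyckStep.D ∧
    ((l.take i).count DyckStep.U : ℤ) = (l.take i).count DyckStep.D + h}

@[simp] lemma peaksFrom_nil (h : ℤ) : peaksFrom h [] = 0 := rfl

lemma peaksFrom_cons_U (h : ℤ) (l : List DyckStep) :
    peaksFrom h (DyckStep.U :: l) =
      peaksFrom (h - 1) l + if l.head? = some DyckStep.D ∧ h = 0 then 1 else 0 := by
  simp only [peaksFrom, Finset.card_filter, List.length_cons, Finset.sum_range_succ']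
  congr 1
  · refine Finset.sum_congr rfl fun i _ => if_congr ?_ rfl rfl
    simp only [List.getElem?_cons_succ, List.take_succ_cons, List.count_cons_self, ne_eq,
      reduceCtorEq, not_false_eq_true, List.count_cons_of_ne]
    push_cast
    refine and_congr_right' (and_congr_right' ⟨fun _ => by omega, fun _ => by omega⟩)
  · refine if_congr ?_ rfl rfl
    simp [List.head?_eq_getElem?, eq_comm]

lemma peaksFrom_cons_D (h : ℤ) (l : List DyckStep) :
    peaksFrom h (DyckStep.D :: l) = peaksFrom (h + 1) l := by
  simp only [peaksFrom, Finset.card_filter, List.length_cons, Finset.sum_range_succ']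
  simp only [List.getElem?_cons_succ, List.take_succ_cons, List.count_cons_self, ne_eq,
      reduceCtorEq, not_false_eq_true, List.count_cons_of_ne, List.getElem?_cons_zero,
      Option.some.injEq, false_and, if_false, add_zero]
  refine Finset.sum_congr rfl fun i _ => if_congr ?_ rfl rfl
  push_cast
  refine and_congr_right' (and_congr_right' ⟨fun _ => by omega, fun _ => by omega⟩)

/-- Peaks add up under concatenation as long as no peak straddles the junction. -/
lemma peaksFrom_append (h : ℤ) (l m : List DyckStep)
    (hlm : l.getLast? ≠ some DyckStep.U ∨ m.head? ≠ some DyckStep.D) :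
    peaksFrom h (l ++ m) = peaksFrom h l +
      peaksFrom (h - l.count DyckStep.U + l.count DyckStep.D) m := by
  induction l generalizing h with
  | nil => simp
  | cons a l ih =>
    have hlm' : l.getLast? ≠ some DyckStep.U ∨ m.head? ≠ some DyckStep.D := by
      refine hlm.imp_left fun h' => ?_
      cases l with
      | nil => simp
      | cons b l => rwa [List.getLast?_cons_cons] at h'
    cases a with
    | U =>
      have hhead : (l ++ m).head? = some DyckStep.D ↔ l.head? = some DyckStep.D := by
        cases l with
        | nil => simpa using hlm
        | cons b l => simp
      rw [List.cons_append, peaksFrom_cons_U, peaksFrom_cons_U, ih _ hlm']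
      simp only [hhead, List.count_cons_self, ne_eq, reduceCtorEq, not_false_eq_true,
        List.count_cons_of_ne]
      push_cast
      rw [show h - ((l.count DyckStep.U : ℤ) + 1) + l.count DyckStep.D
        = h - 1 - l.count DyckStep.U + l.count DyckStep.D by ring]
      ring
    | D =>
      rw [List.cons_append, peaksFrom_cons_D, peaksFrom_cons_D, ih _ hlm']
      simp only [List.count_cons_self, ne_eq, reduceCtorEq, not_false_eq_true,
        List.count_cons_of_ne]
      push_cast
      rw [show h + 1 - (l.count DyckStep.U : ℤ) + l.count DyckStep.D
        = h - l.count DyckStep.U + (l.count DyckStep.D + 1) by ring]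

namespace DyckWord

lemma peaksAtHeight_eq_peaksFrom (p : DyckWord) (n : ℕ) :
    p.peaksAtHeight n = peaksFrom n p.toList := by
  simp only [peaksAtHeight, peaksFrom]
  norm_cast

@[simp] lemma peaksAtHeight_zero_word (n : ℕ) : (0 : DyckWord).peaksAtHeight n = 0 := rfl

/-- A Dyck path is never below the axis, so it has no peaks there. -/
lemma peaksFrom_toList_of_neg (p : DyckWord) {h : ℤ} (hh : h < 0) : peaksFrom h p.toList = 0 := by
  rw [peaksFrom, Finset.card_eq_zero, Finset.filter_eq_empty_iff]
  rintro i - ⟨-, -, hi⟩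
  have := p.count_D_le_count_U i
  omega

lemma head?_toList_ne_D (p : DyckWord) : p.toList.head? ≠ some DyckStep.D := by
  by_cases hp : p.toList = []
  · simp [hp]
  · simp [List.head?_eq_some_head hp, p.head_eq_U hp]

lemma getLast?_toList_ne_U (p : DyckWord) : p.toList.getLast? ≠ some DyckStep.U := by
  by_cases hp : p.toList = []
  · simp [hp]
  · simp [List.getLast?_eq_some_getLast hp, p.getLast_eq_D hp]

lemma peaksAtHeight_add (p q : DyckWord) (n : ℕ) :
    (p + q).peaksAtHeight n = p.peaksAtHeight n + q.peaksAtHeight n := by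
  simp only [peaksAtHeight_eq_peaksFrom]
  rw [show (p + q).toList = p.toList ++ q.toList from rfl,
    peaksFrom_append _ _ _ (Or.inr q.head?_toList_ne_D), p.count_U_eq_count_D, sub_add_cancel]

lemma peaksFrom_nest (p : DyckWord) (h : ℤ) :
    peaksFrom h p.nest.toList = peaksFrom (h - 1) p.toList + if p = 0 ∧ h = 0 then 1 else 0 := by
  have hhead : (p.toList ++ [DyckStep.D]).head? = some DyckStep.D ↔ p = 0 := by
    rw [← toList_eq_nil, List.head?_append, Option.or_eq_some_iff]
    simp [p.head?_toList_ne_D]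
  rw [show p.nest.toList = DyckStep.U :: (p.toList ++ [DyckStep.D]) from rfl, peaksFrom_cons_U,
    peaksFrom_append _ _ _ (Or.inl p.getLast?_toList_ne_U), peaksFrom_cons_D, peaksFrom_nil,
    add_zero]
  simp only [hhead]

lemma peaksAtHeight_succ_nest (p : DyckWord) (n : ℕ) :
    p.nest.peaksAtHeight (n + 1) = p.peaksAtHeight n := by
  simp only [peaksAtHeight_eq_peaksFrom, peaksFrom_nest]
  rw [if_neg (by omega), add_zero, Nat.cast_succ, add_sub_cancel_right]

lemma peaksAtHeight_zero_nest (p : DyckWord) :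
    p.nest.peaksAtHeight 0 = if p = 0 then 1 else 0 := by
  simp [peaksAtHeight_eq_peaksFrom, peaksFrom_nest, peaksFrom_toList_of_neg]

/-! ### Generating functions of Dyck words -/

/-- The finite set of Dyck words of semilength `i`. -/
def words (i : ℕ) : Finset DyckWord :=
  (Finset.univ : Finset {p : DyckWord // p.semilength = i}).map (Function.Embedding.subtype _)

@[simp] lemma mem_words {i : ℕ} {p : DyckWord} : p ∈ words i ↔ p.semilength = i := by
  simp [words]

lemma semilength_eq_zero {p : DyckWord} : p.semilength = 0 ↔ p = 0 := by
  rw [← toList_eq_nil, ← List.length_eq_zero_iff, ← two_mul_semilength_eq_length]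
  omega

lemma words_zero : words 0 = {0} := by
  ext p
  simp [semilength_eq_zero]

lemma card_words (i : ℕ) : (words i).card = catalan i := by
  rw [words, Finset.card_map, Finset.card_univ, card_dyckWord_semilength_eq_catalan]

/-- The first-return decomposition, as a rule for summing over nonempty Dyck words. -/
lemma sum_words_succ {M : Type*} [AddCommMonoid M] (f : DyckWord → M) (i : ℕ) :
    ∑ p ∈ words (i + 1), f p =
      ∑ ab ∈ Finset.HasAntidiagonal.antidiagonal i,
        ∑ pq ∈ words ab.1 ×ˢ words ab.2, f (pq.1.nest + pq.2) := by
  have hne : ∀ p ∈ words (i + 1), p ≠ 0 := by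
    rintro _ hp rfl
    simp at hp
  rw [Finset.sum_sigma']
  refine Finset.sum_bij' (fun p _ => ⟨(p.insidePart.semilength, p.outsidePart.semilength),
      (p.insidePart, p.outsidePart)⟩) (fun x _ => x.2.1.nest + x.2.2) ?_ ?_ ?_ ?_ ?_
  · intro p hp
    have := semilength_insidePart_add_semilength_outsidePart_add_one (hne p hp)
    rw [mem_words] at hp
    simp
    omega
  · rintro ⟨⟨a, b⟩, p, q⟩ h
    simp at h ⊢
    omega
  · intro p hp
    exact nest_insidePart_add_outsidePart (hne p hp)
  · rintro ⟨⟨a, b⟩, p, q⟩ h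
    simp at h
    obtain ⟨-, rfl, rfl⟩ := h
    simp
  · intro p hp
    rw [nest_insidePart_add_outsidePart (hne p hp)]

/-- The generating function `∑ₚ z ^ semilength p * t ^ f p` over all Dyck words `p`. -/
noncomputable def genFun (f : DyckWord → ℕ) : BiSeries :=
  PowerSeries.mk fun i => ∑ p ∈ words i, (PowerSeries.X : PowerSeries ℤ) ^ f p

/-- The first-return decomposition `p ↦ p.nest + q` at the level of generating functions. -/
lemma genFun_eq_of_nest_add {f g : DyckWord → ℕ} (h0 : f 0 = 0)
    (h : ∀ p q, f (p.nest + q) = g p + f q) :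
    genFun f = 1 + BiSeries.z * (genFun g * genFun f) := by
  ext1 i
  cases i with
  | zero => simp [genFun, BiSeries.z, words_zero, h0]
  | succ i =>
    rw [map_add, BiSeries.z, PowerSeries.coeff_succ_X_mul, PowerSeries.coeff_mul]
    simp only [genFun, PowerSeries.coeff_mk, PowerSeries.coeff_one, Nat.succ_ne_zero, if_false,
      zero_add, sum_words_succ, h, pow_add, Finset.sum_mul_sum, Finset.sum_product]

lemma genFun_zero : genFun (fun _ => 0) = BiSeries.catalanGF := by
  ext1 i
  simp [genFun, BiSeries.catalanGF, card_words]

lemma genFun_isEmpty :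
    genFun (fun p => if p = 0 then 1 else 0) = BiSeries.catalanGF + (BiSeries.t - 1) := by
  rw [← genFun_zero]
  ext1 i
  cases i with
  | zero => simp [genFun, words_zero, BiSeries.t]
  | succ i =>
    have hne : ∀ p ∈ words (i + 1), p ≠ 0 := by
      rintro _ hp rfl
      simp at hp
    rw [genFun, genFun, PowerSeries.coeff_mk, map_add, PowerSeries.coeff_mk,
      Finset.sum_congr rfl fun p hp => by rw [if_neg (hne p hp)]]
    simp [BiSeries.t, PowerSeries.coeff_one]

lemma genFun_peaksAtHeight (n : ℕ) :
    genFun (fun p => p.peaksAtHeight n) = 1 + BiSeries.z * BiSeries.G n := by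
  ext1 i
  cases i with
  | zero => simp [genFun, words_zero, BiSeries.z]
  | succ i =>
    rw [map_add, BiSeries.z, PowerSeries.coeff_succ_X_mul]
    ext j
    simp only [genFun, words, BiSeries.G, peakCount, PowerSeries.coeff_mk, PowerSeries.coeff_one,
      Nat.succ_ne_zero, if_false, zero_add, Finset.sum_map, map_sum, PowerSeries.coeff_X_pow,
      Function.Embedding.subtype_apply, Finset.card_filter, Nat.cast_sum, Nat.cast_ite,
      Nat.cast_one, Nat.cast_zero]
    exact Finset.sum_congr rfl fun p _ => if_congr eq_comm rfl rfl

end DyckWord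

/-! ### Functional equations -/

namespace BiSeries

lemma z_ne_zero : z ≠ 0 := PowerSeries.X_ne_zero

lemma catalanGF_eq : catalanGF = 1 + z * catalanGF ^ 2 := by
  rw [sq, ← DyckWord.genFun_zero]
  exact DyckWord.genFun_eq_of_nest_add rfl fun _ _ => rfl

/-- `1 + z G (n + 1)` is the sequence construction applied to `z (1 + z G n)`: the peaks at height
`n + 1` of `p.nest` are the peaks at height `n` of `p`. -/
lemma one_add_z_mul_G_succ (n : ℕ) :
    1 + z * G (n + 1) = 1 + z * ((1 + z * G n) * (1 + z * G (n + 1))) := by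
  simp only [← DyckWord.genFun_peaksAtHeight]
  refine DyckWord.genFun_eq_of_nest_add (by simp) fun p q => ?_
  rw [DyckWord.peaksAtHeight_add, DyckWord.peaksAtHeight_succ_nest]

lemma one_add_z_mul_G_zero :
    1 + z * G 0 = 1 + z * ((catalanGF + (t - 1)) * (1 + z * G 0)) := by
  simp only [← DyckWord.genFun_peaksAtHeight, ← DyckWord.genFun_isEmpty]
  refine DyckWord.genFun_eq_of_nest_add (by simp) fun p q => ?_
  rw [DyckWord.peaksAtHeight_add, DyckWord.peaksAtHeight_zero_nest]

lemma G_succ_mul (n : ℕ) :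
    G (n + 1) * (1 - z - z ^ 2 * G n) = 1 + z * G n := by
  refine mul_left_cancel₀ z_ne_zero ?_
  linear_combination one_add_z_mul_G_succ n

lemma G_one_mul :
    G 1 * (1 - t * z - t * z ^ 2 * catalanGF ^ 2) = 1 + z * catalanGF ^ 2 := by
  -- Elimination of `G 0` through `(1 + z G 0) (1 - z (C + t - 1)) = 1`.
  have h : G 1 * (1 - t * z - z * catalanGF) = 1 := by
    linear_combination (1 - z * (catalanGF + (t - 1))) * G_succ_mul 0
      + (G 1 * z + 1) * one_add_z_mul_G_zero
  linear_combination catalanGF * h + (G 1 * t * z + 1 - G 1) * catalanGF_eq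

lemma denominator_G_one_ne_zero : 1 - t * z - t * z ^ 2 * catalanGF ^ 2 ≠ 0 := by
  intro h
  simpa [z] using congrArg PowerSeries.constantCoeff h

lemma denominator_G_succ_ne_zero (n : ℕ) : 1 - z - z ^ 2 * G n ≠ 0 := by
  intro h
  simpa [z] using congrArg PowerSeries.constantCoeff h

end BiSeries

/-! ### Solving the recurrence with Chebyshev polynomials -/

/-- Closed form for the iterates of the Möbius transformation
`x ↦ (1 + s² x) / (1 - s² - s⁴ x)`, as long as no denominator vanishes. -/
lemma eq_chebyshev_div_of_recurrence {K : Type*} [Field K] [NeZero (2 : K)] {s : K} (hs : s ≠ 0)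
    (g : ℕ → K) (hd : ∀ n, 1 ≤ n → 1 - s ^ 2 - (s ^ 2) ^ 2 * g n ≠ 0)
    (hg : ∀ n, 1 ≤ n → g (n + 1) = (1 + s ^ 2 * g n) / (1 - s ^ 2 - (s ^ 2) ^ 2 * g n))
    (n : ℕ) (hn : 2 ≤ n) :
    g 1 * (s ^ 2) ^ 2 * (Chebyshev.U K ((n : ℤ) - 2)).eval (1 / (2 * s))
        - s ^ 2 * (Chebyshev.U K (n : ℤ)).eval (1 / (2 * s)) ≠ 0 ∧
      g n = (g 1 * s ^ 2 * (Chebyshev.U K ((n : ℤ) - 4)).eval (1 / (2 * s))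
            - (Chebyshev.U K ((n : ℤ) - 2)).eval (1 / (2 * s))) /
          (g 1 * (s ^ 2) ^ 2 * (Chebyshev.U K ((n : ℤ) - 2)).eval (1 / (2 * s))
            - s ^ 2 * (Chebyshev.U K (n : ℤ)).eval (1 / (2 * s))) := by
  have h2 : (2 : K) ≠ 0 := NeZero.ne 2
  -- `u` satisfies the three-term recurrence `s (u (m + 1) + u (m - 1)) = u m`.
  let u : ℤ → K := fun m => (Chebyshev.U K m).eval (1 / (2 * s))
  have hu : ∀ m, s * u (m + 2) = u (m + 1) - s * u m := by
    intro m
    simp only [u, Chebyshev.U_add_two, eval_sub, eval_mul, eval_X, eval_ofNat]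
    field_simp
  change g 1 * (s ^ 2) ^ 2 * u (n - 2) - s ^ 2 * u n ≠ 0 ∧
    g n = (g 1 * s ^ 2 * u (n - 4) - u (n - 2)) / (g 1 * (s ^ 2) ^ 2 * u (n - 2) - s ^ 2 * u n)
  induction n, hn using Nat.le_induction with
  | base =>
    have e2 : s ^ 2 * u 2 = 1 - s ^ 2 := by
      simp [u, Chebyshev.U_two]
      field_simp
      ring
    have e0 : u 0 = 1 := by simp [u]
    have em2 : u (-2) = -1 := by simp [u]
    have hden : g 1 * (s ^ 2) ^ 2 * u ((2 : ℕ) - 2) - s ^ 2 * u (2 : ℕ)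
        = -(1 - s ^ 2 - (s ^ 2) ^ 2 * g 1) := by
      simp only [Nat.cast_ofNat, sub_self, e0, e2]
      ring
    have hnum : g 1 * s ^ 2 * u ((2 : ℕ) - 4) - u ((2 : ℕ) - 2) = -(1 + s ^ 2 * g 1) := by
      rw [show ((2 : ℕ) : ℤ) - 4 = -2 by norm_num,
        show ((2 : ℕ) : ℤ) - 2 = 0 by norm_num, e0, em2]
      ring
    rw [hden, hnum, neg_div_neg_eq]
    exact ⟨neg_ne_zero.2 (hd 1 le_rfl), hg 1 le_rfl⟩
  | succ n hn ih =>
    obtain ⟨hD, ih⟩ := ih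
    have r1 := hu (n - 4)
    have r2 := hu (n - 3)
    have r3 := hu (n - 2)
    have r4 := hu (n - 1)
    rw [show (n : ℤ) - 4 + 2 = n - 2 by ring, show (n : ℤ) - 4 + 1 = n - 3 by ring] at r1
    rw [show (n : ℤ) - 3 + 2 = n - 1 by ring, show (n : ℤ) - 3 + 1 = n - 2 by ring] at r2
    rw [show (n : ℤ) - 2 + 2 = n by ring, show (n : ℤ) - 2 + 1 = n - 1 by ring] at r3
    rw [show (n : ℤ) - 1 + 2 = n + 1 by ring, show (n : ℤ) - 1 + 1 = n by ring] at r4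
    have i1 : ((n + 1 : ℕ) : ℤ) - 2 = n - 1 := by push_cast; ring
    have i2 : ((n + 1 : ℕ) : ℤ) - 4 = n - 3 := by push_cast; ring
    rw [i1, i2, Nat.cast_succ]
    have hdn := hd n (by omega)
    have hgn := hg n (by omega)
    set D := g 1 * (s ^ 2) ^ 2 * u (n - 2) - s ^ 2 * u n with hDdef
    set N := g 1 * s ^ 2 * u (n - 4) - u (n - 2) with hNdef
    have ihD : g n * D = N := by rw [ih, div_mul_cancel₀ _ hD]
    have hnum : s * (g 1 * s ^ 2 * u (n - 3) - u (n - 1)) = (1 + s ^ 2 * g n) * D := by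
      linear_combination -s * (g 1 * s ^ 2) * r1 + s * r3 - s ^ 2 * ihD
    have hden : s * (g 1 * (s ^ 2) ^ 2 * u (n - 1) - s ^ 2 * u (n + 1))
        = (1 - s ^ 2 - (s ^ 2) ^ 2 * g n) * D := by
      linear_combination s ^ 2 * (g 1 * s ^ 2) * r2 - s ^ 2 * r4 - s ^ 2 * hnum
    refine ⟨right_ne_zero_of_mul (hden ▸ mul_ne_zero hdn hD), ?_⟩
    rw [hgn, ← mul_div_mul_right _ _ hD, ← hnum, ← hden, mul_div_mul_left _ _ hs]

/-- Identities are read in an arbitrary field `K` containing the bivariate formal power series and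
a square root `s` of `z`; every denominator is asserted to be nonzero. -/
theorem mainTheorem5 {K : Type*} [Field K] (φ : BiSeries →+* K) (hφ : Function.Injective φ)
    (s : K) (hs : s ^ 2 = φ BiSeries.z) :
    (1 - φ BiSeries.t * φ BiSeries.z
        - φ BiSeries.t * φ BiSeries.z ^ 2 * φ BiSeries.catalanGF ^ 2 ≠ 0 ∧
      φ (BiSeries.G 1) =
        (1 + φ BiSeries.z * φ BiSeries.catalanGF ^ 2) /
          (1 - φ BiSeries.t * φ BiSeries.z
            - φ BiSeries.t * φ BiSeries.z ^ 2 * φ BiSeries.catalanGF ^ 2)) ∧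
    (∀ n : ℕ, 2 ≤ n →
      φ (BiSeries.G 1) * φ BiSeries.z ^ 2 *
            (Polynomial.Chebyshev.U K ((n : ℤ) - 2)).eval (1 / (2 * s))
          - φ BiSeries.z * (Polynomial.Chebyshev.U K (n : ℤ)).eval (1 / (2 * s)) ≠ 0 ∧
      φ (BiSeries.G n) =
        (φ (BiSeries.G 1) * φ BiSeries.z *
              (Polynomial.Chebyshev.U K ((n : ℤ) - 4)).eval (1 / (2 * s))
            - (Polynomial.Chebyshev.U K ((n : ℤ) - 2)).eval (1 / (2 * s))) /
          (φ (BiSeries.G 1) * φ BiSeries.z ^ 2 *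
              (Polynomial.Chebyshev.U K ((n : ℤ) - 2)).eval (1 / (2 * s))
            - φ BiSeries.z * (Polynomial.Chebyshev.U K (n : ℤ)).eval (1 / (2 * s)))) ∧
    (∀ n : ℕ, 2 ≤ n →
      1 - φ BiSeries.z - φ BiSeries.z ^ 2 * φ (BiSeries.G (n - 1)) ≠ 0 ∧
      φ (BiSeries.G n) =
        (1 + φ BiSeries.z * φ (BiSeries.G (n - 1))) /
          (1 - φ BiSeries.z - φ BiSeries.z ^ 2 * φ (BiSeries.G (n - 1)))) := by
  have hz : φ BiSeries.z ≠ 0 := (map_ne_zero_iff φ hφ).2 BiSeries.z_ne_zero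
  have hs0 : s ≠ 0 := by
    rintro rfl
    exact hz (by simpa using hs.symm)
  -- `φ` is injective on a ring of characteristic zero, so `2` is invertible in `K`.
  have h2 : (1 + 1 : BiSeries) ≠ 0 := fun h => by
    have := congrArg (fun f => PowerSeries.constantCoeff (PowerSeries.constantCoeff f)) h
    simp at this
  have : NeZero (2 : K) := ⟨by
    rw [← one_add_one_eq_two, ← map_one φ, ← map_add]
    exact (map_ne_zero_iff φ hφ).2 h2⟩
  have hden : ∀ n, 1 - φ BiSeries.z - φ BiSeries.z ^ 2 * φ (BiSeries.G n) ≠ 0 := fun n => by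
    simpa using (map_ne_zero_iff φ hφ).2 (BiSeries.denominator_G_succ_ne_zero n)
  have hrec : ∀ n, φ (BiSeries.G (n + 1)) = (1 + φ BiSeries.z * φ (BiSeries.G n)) /
      (1 - φ BiSeries.z - φ BiSeries.z ^ 2 * φ (BiSeries.G n)) := fun n => by
    rw [eq_div_iff (hden n)]
    simpa using congrArg φ (BiSeries.G_succ_mul n)
  have hden1 : 1 - φ BiSeries.t * φ BiSeries.z
      - φ BiSeries.t * φ BiSeries.z ^ 2 * φ BiSeries.catalanGF ^ 2 ≠ 0 := by
    simpa using (map_ne_zero_iff φ hφ).2 BiSeries.denominator_G_one_ne_zero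
  refine ⟨⟨hden1, ?_⟩, fun n hn => ?_, fun n hn => ?_⟩
  · rw [eq_div_iff hden1]
    simpa using congrArg φ BiSeries.G_one_mul
  · rw [← hs] at hden hrec ⊢
    exact eq_chebyshev_div_of_recurrence hs0 (fun m => φ (BiSeries.G m)) (fun m _ => hden m)
      (fun m _ => hrec m) n hn
  · obtain ⟨m, rfl⟩ : ∃ m, n = m + 1 := ⟨n - 1, by omega⟩
    exact ⟨hden m, hrec m⟩
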